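/- **Setting.** A *braided circuit* consists of finitely many segments of logical strands, each *primal* or *dual*, connected by the following pieces (every segment has exactly two ends, each at a piece or at an input/output port of the circuit; types are constant along strands): closed ends of loops; braids of a primal with a dual strand; junctions of three strands of the same type; Pauli-frame byproducts; two-body parity measurements. A *bridge* of type $\tau$ is a strand of type $\tau$ that is joined by a junction at each of its two ends to strands of type $\tau$. *ZX interpretation.* A primal closed end is $|0\rangle$ (or $\langle 0|$), a dual one $|+\rangle$ (or $\langle +|$); a braid is a CNOT with dual control and primal target; a junction is a phase-free three-legged spider, a $Z$-spider if primal and an $X$-spider if dual. The $ZZ$-measurement is the circuit in which an ancilla $|0\rangle$ is the target of CNOTs controlled by the two wires and is then measured in the $Z$ basis; the $XX$-measurement is the circuit in which an ancilla $|+\rangle$ controls CNOTs onto the two wires and is then measured in the $X$ basis. Contraction gives the linear map from inputs to outputs implemented by the circuit. *Correlation surfaces.* Each segment carries a tube bit and a sheet bit in $\mathbb F_2$ (primal: tube $=X$, sheet $=Z$; dual: tube $=Z$, sheet $=X$). At a closed end there is no tube; at a braid both sheets continue and each sheet connects to the tube of the other strand; at a junction the tubes around the three strands are all connected and the sheets have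 even parity; a Pauli byproduct changes nothing; at a measurement the operators propagate through the measurement circuit. The *correlations* of the circuit are the pairs of input and output labels that extend to all segments. Let the bridge type of the spider colour $Z$ be primal and that of $X$ be dual. **Proposition.** In braided circuits, every two-body measurement can be replaced with a bridge between strands of the same type, whose type is determined by the spider colour. Precisely: 1. Let $C$ be a braided circuit containing a $BB$-measurement ($B\in\{X,Z\}$) with outcome $(-1)^m$ of two strands of arbitrary types, and let $\tau$ be the bridge type of $B$. Replace the measurement by a bridge of type $\tau$, attached to each of the two measured strands directly if that strand has type $\tau$, and otherwise to a new trivial loop of type $\tau$ that is braided twice with that strand, once before and once after its junction with the bridge; if $m=1$, the bridge carries a Pauli byproduct ($X$ if $\tau$ is primal, $Z$ if $\tau$ is dual). The result is a braided circuit that implements the same linear map from inputs to outputs and has the same correlations. 2. By such replacements, every braided circuit can be transformed into a braided circuit without two-body measurements that implements the same linear map and has the same correlations. 3. On two strands of type $t$ and nothing else, the $BB$-measurement with outcome $+1$ is implemented by a bridge attached directly to these strands if and only if $t$ is the bridge type of $B$. This holds both for the linear maps (up to a scalar) and for the correlations. -/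

import Mathlib

/-- The two types of strands (defects). -/
inductive StrandType
  | primal
  | dual
  deriving DecidableEq

/-- The two spider colours of the ZX calculus, i.e. the two bases of a logical operator:
`Z` (green) and `X` (red). A `ZZ`-measurement touches its two wires with `Z`-spiders,
an `XX`-measurement with `X`-spiders. -/
inductive Colour
  | Z
  | X
  deriving DecidableEq

/-- The logical operator carried by a sheet: `Z` on primal strands, `X` on dual ones.
It is also the basis in which a loop of that type is initialised and measured. -/
def StrandType.sheet : StrandType → Colour
  | .primal => .Z
  | .dual => .X

/-- The logical operator carried by a tube: `X` on primal strands, `Z` on dual ones. -/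
def StrandType.tube : StrandType → Colour
  | .primal => .X
  | .dual => .Z

/-- The type of the bridge that belongs to a spider colour: `ZZ`-measurements are bridges in the
primal space, `XX`-measurements are bridges in the dual space. -/
def Colour.bridgeType : Colour → StrandType
  | .Z => .primal
  | .X => .dual

/-- The pieces from which a braided circuit is assembled. `S` is the set of strand segments; a
segment is a piece of a logical strand between two consecutive pieces.
* `closedEnd s`: the strand closes up (the loop is initialised or measured);
* `braid p p' d d'`: the primal strand `p → p'` is braided with the dual strand `d → d'`;
* `junction a b c`: three strands of the same type meet;
* `frame B m s s'`: bookkeeping of the Pauli frame, the strand `s → s'` carries the Pauli byproduct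
  `B ^ m` (a plain strand if `m = 0`);
* `parity B m q q' r r'`: the two-body `BB`-measurement of `q → q'` and `r → r'` with
  outcome `(-1) ^ m`. -/
inductive Element (S : Type)
  | closedEnd (s : S)
  | braid (p p' d d' : S)
  | junction (a b c : S)
  | frame (B : Colour) (m : ZMod 2) (s s' : S)
  | parity (B : Colour) (m : ZMod 2) (q q' r r' : S)

namespace Element

variable {S T : Type}

/-- Relabelling of the segments. -/
def map (f : S → T) : Element S → Element T
  | closedEnd s => closedEnd (f s)
  | braid p p' d d' => braid (f p) (f p') (f d) (f d')
  | junction a b c => junction (f a) (f b) (f c)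
  | frame B m s s' => frame B m (f s) (f s')
  | parity B m q q' r r' => parity B m (f q) (f q') (f r) (f r')

/-- The segments that end at a piece, with multiplicity. -/
def segments : Element S → List S
  | closedEnd s => [s]
  | braid p p' d d' => [p, p', d, d']
  | junction a b c => [a, b, c]
  | frame _ _ s s' => [s, s']
  | parity _ _ q q' r r' => [q, q', r, r']

/-- Only strands of opposite type are braided and only strands of the same type are joined; the
type of a strand does not change along the strand. -/
def WellTyped (ty : S → StrandType) : Element S → Prop
  | closedEnd _ => True
  | braid p p' d d' => ty p = .primal ∧ ty p' = .primal ∧ ty d = .dual ∧ ty d' = .dual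
  | junction a b c => ty a = ty b ∧ ty b = ty c
  | frame _ _ s s' => ty s = ty s'
  | parity _ _ q q' r r' => ty q = ty q' ∧ ty r = ty r'

/-- The piece is a two-body measurement. -/
def IsParity : Element S → Prop
  | parity _ _ _ _ _ _ => True
  | _ => False

end Element

/-- A braided circuit with inputs `I` and outputs `O`: typed strand segments, connected by pieces.
No time order is imposed on the pieces; bridges may be present. -/
structure BraidedCircuit (I O : Type) where
  Seg : Type
  [fintypeSeg : Fintype Seg]
  [decEqSeg : DecidableEq Seg]
  ty : Seg → StrandType
  inp : I → Seg
  out : O → Seg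
  elems : List (Element Seg)

attribute [instance] BraidedCircuit.fintypeSeg BraidedCircuit.decEqSeg

/-- The pieces respect the strand types, and every segment has exactly two ends. -/
def BraidedCircuit.WellFormed {I O : Type} [Fintype I] [Fintype O]
    (C : BraidedCircuit I O) : Prop :=
  (∀ E ∈ C.elems, E.WellTyped C.ty) ∧
    ∀ s : C.Seg, (C.elems.flatMap Element.segments).count s
      + (Finset.univ.filter fun i => C.inp i = s).card
      + (Finset.univ.filter fun o => C.out o = s).card = 2

/-! ### The ZX interpretation: logical operations as linear maps -/

/-- The amplitude at the computational basis state `x` of the `k`-th eigenvector of the Pauli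
operator `B`: `|0⟩, |1⟩` for `Z` and `|+⟩, |-⟩` for `X`. -/
noncomputable def amp : Colour → ZMod 2 → ZMod 2 → ℂ
  | .Z, k, x => if x = k then 1 else 0
  | .X, k, x => (1 / (Real.sqrt 2 : ℂ)) * (-1) ^ (k * x).val

/-- The phase-free three-legged spider of colour `B`. -/
noncomputable def spider (B : Colour) (x y z : ZMod 2) : ℂ :=
  ∑ k : ZMod 2, amp B k x * amp B k y * amp B k z

/-- The CNOT with control `c → c'` and target `t → t'`. -/
noncomputable def cnot (c c' t t' : ZMod 2) : ℂ :=
  if c' = c ∧ t' = t + c then 1 else 0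

/-- The Pauli operator `B ^ m`. -/
noncomputable def pauli : Colour → ZMod 2 → ZMod 2 → ZMod 2 → ℂ
  | .X, m, x, x' => if x' = x + m then 1 else 0
  | .Z, m, x, x' => if x' = x then (-1) ^ (m * x).val else 0

/-- The two-body measurement circuits. `ZZ`: an ancilla in `|0⟩` is the target of CNOTs controlled
by the two qubits, and is then measured in the `Z` basis. `XX`: an ancilla in `|+⟩` controls CNOTs
onto the two qubits, and is then measured in the `X` basis. The outcome is `(-1) ^ m`. -/
noncomputable def parityCircuit : Colour → ZMod 2 → ZMod 2 → ZMod 2 → ZMod 2 → ZMod 2 → ℂ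
  | .Z, m, q, q', r, r' => ∑ a : ZMod 2, ∑ a' : ZMod 2, ∑ a'' : ZMod 2,
      amp .Z 0 a * cnot q q' a a' * cnot r r' a' a'' * amp .Z m a''
  | .X, m, q, q', r, r' => ∑ a : ZMod 2, ∑ a' : ZMod 2, ∑ a'' : ZMod 2,
      amp .X 0 a * cnot a a' q q' * cnot a' a'' r r' * amp .X m a''

/-- The ZX interpretation of a piece, evaluated on a basis state of each segment. A primal closed
end is `|0⟩`, a dual one `|+⟩`; a braid is a CNOT with dual control and primal target; a junction
of type `t` is a spider. -/
noncomputable def Element.tensor {S : Type} (ty : S → StrandType) (x : S → ZMod 2) :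
    Element S → ℂ
  | .closedEnd s => amp (ty s).sheet 0 (x s)
  | .braid p p' d d' => cnot (x d) (x d') (x p) (x p')
  | .junction a b c => spider (ty a).sheet (x a) (x b) (x c)
  | .frame B m s s' => pauli B m (x s) (x s')
  | .parity B m q q' r r' => parityCircuit B m (x q) (x q') (x r) (x r')

open Classical in
/-- The linear map from the input qubits to the output qubits that the circuit implements, as a
matrix in the computational basis. -/
noncomputable def BraidedCircuit.computation {I O : Type} (C : BraidedCircuit I O) :
    Matrix (O → ZMod 2) (I → ZMod 2) ℂ :=
  fun y x => ∑ s : C.Seg → ZMod 2,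
    if (∀ i, s (C.inp i) = x i) ∧ (∀ o, s (C.out o) = y o) then
      (C.elems.map (Element.tensor C.ty s)).prod
    else 0

/-! ### Correlation surfaces -/

/-- What a correlation surface does along a segment: whether (mod 2) it contains the tube around
the segment, and whether it contains the sheet spanned along the segment. -/
structure SurfaceLabel where
  tube : ZMod 2
  sheet : ZMod 2

/-- The exponent of `X` in the logical operator of a label. -/
def SurfaceLabel.x (t : StrandType) (l : SurfaceLabel) : ZMod 2 :=
  match t with
  | .primal => l.tube
  | .dual => l.sheet

/-- The exponent of `Z` in the logical operator of a label. -/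
def SurfaceLabel.z (t : StrandType) (l : SurfaceLabel) : ZMod 2 :=
  match t with
  | .primal => l.sheet
  | .dual => l.tube

/-- Propagation of Pauli operators (pairs of an `X`- and a `Z`-exponent) through a CNOT with
control `c → c'` and target `t → t'`. -/
def CnotFlow (c c' t t' : ZMod 2 × ZMod 2) : Prop :=
  c'.1 = c.1 ∧ c'.2 = c.2 + t.2 ∧ t'.1 = t.1 + c.1 ∧ t'.2 = t.2

/-- Propagation of Pauli operators through the two-body measurement circuits: at its initialisation
and at its measurement the ancilla may only carry the operator of its basis. -/
def ParityFlow : Colour → (q q' r r' : ZMod 2 × ZMod 2) → Prop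
  | .Z, q, q', r, r' => ∃ a a' a'' : ZMod 2 × ZMod 2,
      a.1 = 0 ∧ CnotFlow q q' a a' ∧ CnotFlow r r' a' a'' ∧ a''.1 = 0
  | .X, q, q', r, r' => ∃ a a' a'' : ZMod 2 × ZMod 2,
      a.2 = 0 ∧ CnotFlow a a' q q' ∧ CnotFlow a' a'' r r' ∧ a''.2 = 0

/-- The local rules for correlation surfaces. A closed end supports the sheet but not the tube; at
a braid the sheets continue and each of them connects to the tube of the other strand; at a junction
the tubes around the three strands are connected to each other, while the sheets are connected in
pairs (three valid nontrivial constructions). The Pauli frame only affects signs. -/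
def Element.Supports {S : Type} (ty : S → StrandType) (l : S → SurfaceLabel) : Element S → Prop
  | .closedEnd s => (l s).tube = 0
  | .braid p p' d d' =>
      (l p').sheet = (l p).sheet ∧ (l d').sheet = (l d).sheet ∧
      (l p').tube = (l p).tube + (l d).sheet ∧ (l d').tube = (l d).tube + (l p).sheet
  | .junction a b c =>
      (l a).tube = (l b).tube ∧ (l b).tube = (l c).tube ∧
      (l a).sheet + (l b).sheet + (l c).sheet = 0
  | .frame _ _ s s' => l s = l s'
  | .parity B _ q q' r r' => ParityFlow B
      ((l q).x (ty q), (l q).z (ty q)) ((l q').x (ty q'), (l q').z (ty q'))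
      ((l r).x (ty r), (l r).z (ty r)) ((l r').x (ty r'), (l r').z (ty r'))

/-- The pairs of an input and an output logical operator (both given by tubes and sheets) that are
connected by a correlation surface of the circuit. -/
def BraidedCircuit.correlations {I O : Type} (C : BraidedCircuit I O) :
    Set ((I → SurfaceLabel) × (O → SurfaceLabel)) :=
  {b | ∃ l : C.Seg → SurfaceLabel, (∀ E ∈ C.elems, E.Supports C.ty l) ∧
    (∀ i, l (C.inp i) = b.1 i) ∧ (∀ o, l (C.out o) = b.2 o)}

/-! ### Replacing a measurement by a bridge -/

/-- The segments created when a trivial loop is put around a strand: the segment `mid` of the strand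
between its two braids with the loop, and the segments of the loop, where `l₀ → l₁` is braided with
the strand before `mid` and `l₂ → l₃` after `mid`. -/
inductive LoopSeg
  | mid
  | l₀
  | l₁
  | l₂
  | l₃
  deriving DecidableEq

instance : Fintype LoopSeg where
  elems := {.mid, .l₀, .l₁, .l₂, .l₃}
  complete := by
    intro l
    cases l <;> simp

/-- The types of these segments for a loop of type `τ` around a strand of type `t`. -/
def LoopSeg.ty (τ t : StrandType) : LoopSeg → StrandType
  | .mid => t
  | _ => τ

/-- The braid of a strand `l → l'` of type `τ` with a strand `w → w'` of the opposite type. -/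
def braidWith {S : Type} (τ : StrandType) (l l' w w' : S) : Element S :=
  match τ with
  | .primal => .braid l l' w w'
  | .dual => .braid w w' l l'

/-- Attach an end `e` of a bridge of type `τ` to the strand `q → q'` of type `t`: directly if
`t = τ`, and otherwise to a trivial loop of type `τ`, which is braided twice with that
strand. -/
def attachBridge {S : Type} (τ t : StrandType) (q q' e : S) (new : LoopSeg → t ≠ τ → S) :
    List (Element S) :=
  if h : t = τ then [.junction q q' e]
  else
    [.closedEnd (new .l₀ h),
      braidWith τ (new .l₀ h) (new .l₁ h) q (new .mid h),
      .junction (new .l₁ h) (new .l₂ h) e,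
      braidWith τ (new .l₂ h) (new .l₃ h) (new .mid h) q',
      .closedEnd (new .l₃ h)]

/-- For a circuit with pieces `l₁ ++ parity B m q q' r r' :: l₂`: replace that measurement by a
bridge of type `B.bridgeType`. The bridge is a strand (its two halves are the new segments `false`
and `true`) from a strand of its own type belonging to `q → q'` to one belonging to `r → r'`;
the outcome `m` becomes a Pauli byproduct on the bridge. -/
def BraidedCircuit.replaceByBridge {I O : Type} (C : BraidedCircuit I O)
    (l₁ l₂ : List (Element C.Seg)) (B : Colour) (m : ZMod 2) (q q' r r' : C.Seg) :
    BraidedCircuit I O where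
  Seg := C.Seg ⊕ Bool ⊕ {_l : LoopSeg // C.ty q ≠ B.bridgeType} ⊕
    {_l : LoopSeg // C.ty r ≠ B.bridgeType}
  ty := Sum.elim C.ty (Sum.elim (fun _ => B.bridgeType)
    (Sum.elim (fun l => l.1.ty B.bridgeType (C.ty q)) (fun l => l.1.ty B.bridgeType (C.ty r))))
  inp := fun i => .inl (C.inp i)
  out := fun o => .inl (C.out o)
  elems := l₁.map (Element.map .inl) ++
    (attachBridge B.bridgeType (C.ty q) (.inl q) (.inl q') (.inr (.inl false))
        (fun l h => .inr (.inr (.inl ⟨l, h⟩)))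
      ++ [.frame B.bridgeType.tube m (.inr (.inl false)) (.inr (.inl true))]
      ++ attachBridge B.bridgeType (C.ty r) (.inl r) (.inl r') (.inr (.inl true))
        (fun l h => .inr (.inr (.inr ⟨l, h⟩))))
    ++ l₂.map (Element.map .inl)

/-- `C'` arises from `C` by replacing one two-body measurement by a bridge. -/
inductive BridgeReplacement {I O : Type} : BraidedCircuit I O → BraidedCircuit I O → Prop
  | replace (C : BraidedCircuit I O) (l₁ l₂ : List (Element C.Seg)) (B : Colour) (m : ZMod 2)
      (q q' r r' : C.Seg) (h : C.elems = l₁ ++ .parity B m q q' r r' :: l₂) :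
      BridgeReplacement C (C.replaceByBridge l₁ l₂ B m q q' r r')

/-- Two strands of type `t` on which the `BB`-measurement is performed (with outcome `+1`), and
nothing else. -/
def twoStrandMeasurement (t : StrandType) (B : Colour) : BraidedCircuit (Fin 2) (Fin 2) where
  Seg := Fin 2 × Bool
  ty := fun _ => t
  inp := fun i => (i, false)
  out := fun o => (o, true)
  elems := [.parity B 0 (0, false) (0, true) (1, false) (1, true)]

/-- Two strands of type `t`, connected by a bridge, and nothing else. -/
def twoStrandBridge (t : StrandType) : BraidedCircuit (Fin 2) (Fin 2) where
  Seg := (Fin 2 × Bool) ⊕ Unit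
  ty := fun _ => t
  inp := fun i => .inl (i, false)
  out := fun o => .inl (o, true)
  elems := [.junction (.inl (0, false)) (.inl (0, true)) (.inr ()),
    .junction (.inl (1, false)) (.inl (1, true)) (.inr ())]

/-! A two-body measurement is two spiders of colour `B` on the measured strands, joined by an edge
carrying the outcome as a Pauli byproduct (`sum_spider_pauli_spider`). A spider of that colour is a
junction of type `B.bridgeType`, so on strands of this type the edge is the bridge. On a strand of
the other type, the loop transfers the junction to the strand: closed ends, two CNOTs and the
junction contract to the same spider (`sum_attachBridge`). All these identities are exact, so no
scalar appears. Since the replacement is local, contracting the new segments for fixed labels of the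
old ones gives back the measurement (`sum_prod_bridgeElems`). Correlations follow the same
factorisation: `BridgeFlow` is the Pauli flow of one spider, `exists_bridgeFlow_iff` glues two of
them into the measurement, and the loop realises exactly this flow. Removing all measurements is an
induction on their number. For two bare strands with a mismatched bridge, single matrix entries and
a single pair of labels separate measurement and bridge. -/

/-! ### Relabelling -/

namespace Element

variable {S T : Type}

theorem segments_map (f : S → T) (E : Element S) : (E.map f).segments = E.segments.map f := by
  cases E <;> rfl

theorem wellTyped_map (f : S → T) (ty : T → StrandType) (E : Element S) :
    (E.map f).WellTyped ty ↔ E.WellTyped (ty ∘ f) := by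
  cases E <;> rfl

theorem tensor_map (f : S → T) (ty : T → StrandType) (x : T → ZMod 2) (E : Element S) :
    (E.map f).tensor ty x = E.tensor (ty ∘ f) (x ∘ f) := by
  cases E <;> rfl

theorem supports_map (f : S → T) (ty : T → StrandType) (l : T → SurfaceLabel) (E : Element S) :
    (E.map f).Supports ty l ↔ E.Supports (ty ∘ f) (l ∘ f) := by
  cases E <;> rfl

end Element

theorem flatMap_segments_map {S T : Type} (f : S → T) (L : List (Element S)) :
    (L.map (Element.map f)).flatMap Element.segments = (L.flatMap Element.segments).map f := by
  induction L with
  | nil => rfl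
  | cons E L ih => simp [Element.segments_map, ih]

theorem prod_tensor_map {S T : Type} (f : S → T) (ty : T → StrandType) (x : T → ZMod 2)
    (L : List (Element S)) :
    ((L.map (Element.map f)).map (Element.tensor ty x)).prod
      = (L.map (Element.tensor (ty ∘ f) (x ∘ f))).prod := by
  rw [List.map_map]
  congr 1
  exact List.map_congr_left fun E _ => Element.tensor_map f ty x E

/-! ### The segments and pieces after a replacement -/

/-- The segments of a circuit after a measurement of strands of types `t` and `u` is replaced by
a bridge of type `τ`. -/
abbrev BridgeSeg (S : Type) (τ t u : StrandType) : Type :=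
  S ⊕ Bool ⊕ {_l : LoopSeg // t ≠ τ} ⊕ {_l : LoopSeg // u ≠ τ}

/-- The types of these segments. -/
def bridgeTy {S : Type} (ty : S → StrandType) (τ t u : StrandType) :
    BridgeSeg S τ t u → StrandType :=
  Sum.elim ty (Sum.elim (fun _ => τ) (Sum.elim (fun l => l.1.ty τ t) (fun l => l.1.ty τ u)))

/-- The pieces at the first end of the bridge. -/
def firstEnd {S : Type} (τ t u : StrandType) (q q' : S) : List (Element (BridgeSeg S τ t u)) :=
  attachBridge τ t (.inl q) (.inl q') (.inr (.inl false)) (fun l h => .inr (.inr (.inl ⟨l, h⟩)))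

/-- The pieces at the second end of the bridge. -/
def secondEnd {S : Type} (τ t u : StrandType) (r r' : S) : List (Element (BridgeSeg S τ t u)) :=
  attachBridge τ u (.inl r) (.inl r') (.inr (.inl true)) (fun l h => .inr (.inr (.inr ⟨l, h⟩)))

/-- The pieces of a circuit after a measurement is replaced by a bridge. -/
def bridgeElems {S : Type} (l₁ l₂ : List (Element S)) (B : Colour) (m : ZMod 2)
    (τ t u : StrandType) (q q' r r' : S) : List (Element (BridgeSeg S τ t u)) :=
  l₁.map (Element.map .inl) ++ (firstEnd τ t u q q' ++
    [.frame B m (.inr (.inl false)) (.inr (.inl true))] ++ secondEnd τ t u r r') ++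
    l₂.map (Element.map .inl)

theorem forall_mem_bridgeElems {S : Type} {l₁ l₂ : List (Element S)} {B : Colour} {m : ZMod 2}
    {τ t u : StrandType} {q q' r r' : S} {P : Element (BridgeSeg S τ t u) → Prop} :
    (∀ E ∈ bridgeElems l₁ l₂ B m τ t u q q' r r', P E) ↔
      (∀ E ∈ l₁, P (E.map .inl)) ∧ (∀ E ∈ firstEnd τ t u q q', P E) ∧
      P (.frame B m (.inr (.inl false)) (.inr (.inl true))) ∧
      (∀ E ∈ secondEnd τ t u r r', P E) ∧ ∀ E ∈ l₂, P (E.map .inl) := by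
  simp only [bridgeElems, List.forall_mem_append, List.forall_mem_map, List.forall_mem_singleton,
    and_assoc]

/-! ### Amplitudes -/

theorem StrandType.eq_primal_or_dual (t : StrandType) : t = .primal ∨ t = .dual := by
  cases t <;> simp

theorem sum_zmod_two {M : Type*} [AddCommMonoid M] (f : ZMod 2 → M) :
    ∑ a : ZMod 2, f a = f 0 + f 1 :=
  Fin.sum_univ_two f

theorem zmod_two_cases (a : ZMod 2) : a = 0 ∨ a = 1 := by
  revert a; decide

theorem one_add_one_zmod_two : (1 : ZMod 2) + 1 = 0 := by decide

theorem inv_sqrt_two_mul_self :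
    ((Real.sqrt 2 : ℝ) : ℂ)⁻¹ * ((Real.sqrt 2 : ℝ) : ℂ)⁻¹ = 1 / 2 := by
  rw [← mul_inv, ← Complex.ofReal_mul, Real.mul_self_sqrt (by norm_num)]
  norm_num

theorem val_one_zmod_two : (1 : ZMod 2).val = 1 := rfl

theorem spider_Z (x y z : ZMod 2) : spider .Z x y z = if x = y ∧ y = z then 1 else 0 := by
  rcases zmod_two_cases x with rfl | rfl <;> rcases zmod_two_cases y with rfl | rfl <;>
    rcases zmod_two_cases z with rfl | rfl <;> simp [spider, amp]

/-- The signs sum to 2 or 0, and 2 · 2^(-3/2) = 2^(-1/2). Two such factors make up the 1/2 of the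
`XX`-measurement circuit. -/
theorem spider_X (x y z : ZMod 2) :
    spider .X x y z = if x + y + z = 0 then ((Real.sqrt 2 : ℝ) : ℂ)⁻¹ else 0 := by
  have h := inv_sqrt_two_mul_self
  rcases zmod_two_cases x with rfl | rfl <;> rcases zmod_two_cases y with rfl | rfl <;>
    rcases zmod_two_cases z with rfl | rfl <;>
    simp [spider, amp, sum_zmod_two, one_add_one_zmod_two, val_one_zmod_two] <;>
    linear_combination 2 * ((Real.sqrt 2 : ℝ) : ℂ)⁻¹ * h

/-- The ancilla accumulates `q + r`, which the readout compares with `m`. -/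
theorem parityCircuit_Z (m q q' r r' : ZMod 2) :
    parityCircuit .Z m q q' r r' = if q' = q ∧ r' = r ∧ r = q + m then 1 else 0 := by
  rcases zmod_two_cases m with rfl | rfl <;>
  rcases zmod_two_cases q with rfl | rfl <;> rcases zmod_two_cases q' with rfl | rfl <;>
    rcases zmod_two_cases r with rfl | rfl <;> rcases zmod_two_cases r' with rfl | rfl <;>
    simp [parityCircuit, amp, cnot, sum_zmod_two, one_add_one_zmod_two]

/-- The ancilla value `a` flips both qubits or neither, so `a = q + q' = r + r'`; its readout
contributes the sign, and its two `X`-basis amplitudes the factor 1/2. -/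
theorem parityCircuit_X (m q q' r r' : ZMod 2) :
    parityCircuit .X m q q' r r'
      = if q + q' = r + r' then 1 / 2 * (-1) ^ (m * (q + q')).val else 0 := by
  have h := inv_sqrt_two_mul_self
  rcases zmod_two_cases m with rfl | rfl <;>
  rcases zmod_two_cases q with rfl | rfl <;> rcases zmod_two_cases q' with rfl | rfl <;>
    rcases zmod_two_cases r with rfl | rfl <;> rcases zmod_two_cases r' with rfl | rfl <;>
    simp [parityCircuit, amp, cnot, sum_zmod_two, one_add_one_zmod_two, val_one_zmod_two] <;>
    linear_combination h

/-- A two-body measurement is a pair of spiders joined by an edge with a Pauli byproduct. -/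
theorem sum_spider_pauli_spider (B : Colour) (m q q' r r' : ZMod 2) :
    ∑ e : ZMod 2, ∑ e' : ZMod 2, spider B.bridgeType.sheet q q' e *
      pauli B.bridgeType.tube m e e' * spider B.bridgeType.sheet r r' e'
      = parityCircuit B m q q' r r' := by
  have h := inv_sqrt_two_mul_self
  cases B
  · rw [parityCircuit_Z]
    simp only [Colour.bridgeType, StrandType.sheet, StrandType.tube, spider_Z]
    rcases zmod_two_cases m with rfl | rfl <;>
    rcases zmod_two_cases q with rfl | rfl <;> rcases zmod_two_cases q' with rfl | rfl <;>
      rcases zmod_two_cases r with rfl | rfl <;> rcases zmod_two_cases r' with rfl | rfl <;>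
      simp [pauli, sum_zmod_two, one_add_one_zmod_two]
  · rw [parityCircuit_X]
    simp only [Colour.bridgeType, StrandType.sheet, StrandType.tube, spider_X]
    rcases zmod_two_cases m with rfl | rfl <;>
    rcases zmod_two_cases q with rfl | rfl <;> rcases zmod_two_cases q' with rfl | rfl <;>
      rcases zmod_two_cases r with rfl | rfl <;> rcases zmod_two_cases r' with rfl | rfl <;>
      simp [pauli, sum_zmod_two, one_add_one_zmod_two, val_one_zmod_two] <;>
      linear_combination h

/-- Labellings of the segments of a loop. -/
def LoopSeg.arrowEquiv (α : Type*) : (LoopSeg → α) ≃ α × α × α × α × α where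
  toFun f := (f .mid, f .l₀, f .l₁, f .l₂, f .l₃)
  invFun p
    | .mid => p.1
    | .l₀ => p.2.1
    | .l₁ => p.2.2.1
    | .l₂ => p.2.2.2.1
    | .l₃ => p.2.2.2.2
  left_inv f := by funext l; cases l <;> rfl
  right_inv _ := rfl

theorem LoopSeg.sum_arrow (F : ZMod 2 → ZMod 2 → ZMod 2 → ZMod 2 → ZMod 2 → ℂ) :
    ∑ f : LoopSeg → ZMod 2, F (f .mid) (f .l₀) (f .l₁) (f .l₂) (f .l₃)
      = ∑ a, ∑ b, ∑ c, ∑ d, ∑ e, F a b c d e := by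
  rw [Fintype.sum_equiv (LoopSeg.arrowEquiv (ZMod 2))
    (fun f => F (f .mid) (f .l₀) (f .l₁) (f .l₂) (f .l₃))
    (fun p => F p.1 p.2.1 p.2.2.1 p.2.2.2.1 p.2.2.2.2) (fun _ => rfl)]
  simp only [Fintype.sum_prod_type]

/-- The first CNOT copies `q` onto the loop, the junction shares this value with `e`, and the second
CNOT erases it, as the final closed end demands. -/
theorem sum_primal_loop (q q' e : ZMod 2) :
    ∑ a : ZMod 2, ∑ b, ∑ c, ∑ d, ∑ f, amp .Z 0 b * (cnot q a b c * (spider .Z c d e *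
      (cnot a q' d f * amp .Z 0 f))) = spider .Z q q' e := by
  simp only [spider_Z]
  rcases zmod_two_cases q with rfl | rfl <;> rcases zmod_two_cases q' with rfl | rfl <;>
    rcases zmod_two_cases e with rfl | rfl <;>
    simp [amp, cnot, sum_zmod_two, one_add_one_zmod_two]

/-- The two halves of the loop shift the strand by `c` and `d`, and the junction forces `c + d = e`.
The remaining free value gives two equal terms of size 2^(-3/2). -/
theorem sum_dual_loop (q q' e : ZMod 2) :
    ∑ a : ZMod 2, ∑ b, ∑ c, ∑ d, ∑ f, amp .X 0 b * (cnot b c q a * (spider .X c d e *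
      (cnot d f a q' * amp .X 0 f))) = spider .X q q' e := by
  have h := inv_sqrt_two_mul_self
  simp only [spider_X]
  rcases zmod_two_cases q with rfl | rfl <;> rcases zmod_two_cases q' with rfl | rfl <;>
    rcases zmod_two_cases e with rfl | rfl <;>
    simp [amp, cnot, sum_zmod_two, one_add_one_zmod_two] <;>
    linear_combination 2 * ((Real.sqrt 2 : ℝ) : ℂ)⁻¹ * h

/-- Summing over the segments of the auxiliary loop, an attached bridge is a spider. -/
theorem sum_attachBridge {S : Type} (τ t : StrandType) (q q' e : S) (new : LoopSeg → t ≠ τ → S)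
    (ty : S → StrandType) (hq : ty q = t) (hnew : ∀ l h, ty (new l h) = l.ty τ t)
    (x : ({_l : LoopSeg // t ≠ τ} → ZMod 2) → S → ZMod 2) (xq xq' xe : ZMod 2)
    (hxq : ∀ f, x f q = xq) (hxq' : ∀ f, x f q' = xq') (hxe : ∀ f, x f e = xe)
    (hx : ∀ f l h, x f (new l h) = f ⟨l, h⟩) :
    ∑ f, ((attachBridge τ t q q' e new).map (Element.tensor ty (x f))).prod
      = spider τ.sheet xq xq' xe := by
  by_cases h : t = τ
  -- Without loop segments there is exactly one labelling to sum over.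
  · have : IsEmpty {_l : LoopSeg // t ≠ τ} := ⟨fun l => l.2 h⟩
    simp [attachBridge, h, Element.tensor, hxq, hxq', hxe, hq]
  · let eqv : ({_l : LoopSeg // t ≠ τ} → ZMod 2) ≃ (LoopSeg → ZMod 2) :=
      (Equiv.subtypeUnivEquiv (p := fun _ : LoopSeg => t ≠ τ) (fun _ => h)).arrowCongr
        (Equiv.refl _)
    have key : ∀ f : {_l : LoopSeg // t ≠ τ} → ZMod 2, ∀ l, eqv f l = f ⟨l, h⟩ := fun _ _ => rfl
    rcases τ.eq_primal_or_dual with rfl | rfl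
    · simp only [StrandType.sheet]
      rw [← sum_primal_loop, ← LoopSeg.sum_arrow]
      refine Fintype.sum_equiv eqv _ _ fun f => ?_
      simp [attachBridge, h, Element.tensor, braidWith, hxq, hxq', hxe, hx, hnew, key,
        LoopSeg.ty, StrandType.sheet]
    · simp only [StrandType.sheet]
      rw [← sum_dual_loop, ← LoopSeg.sum_arrow]
      refine Fintype.sum_equiv eqv _ _ fun f => ?_
      simp [attachBridge, h, Element.tensor, braidWith, hxq, hxq', hxe, hx, hnew, key,
        LoopSeg.ty, StrandType.sheet]

/-- The pieces attached at one end of a bridge do not see the labels of other segments. -/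
theorem prod_attachBridge_congr {S : Type} (τ t : StrandType) (q q' e : S)
    (new : LoopSeg → t ≠ τ → S) (ty : S → StrandType) (x y : S → ZMod 2) (hq : x q = y q)
    (hq' : x q' = y q') (he : x e = y e) (hnew : ∀ l h, x (new l h) = y (new l h)) :
    ((attachBridge τ t q q' e new).map (Element.tensor ty x)).prod
      = ((attachBridge τ t q q' e new).map (Element.tensor ty y)).prod := by
  by_cases h : t = τ
  · simp [attachBridge, h, Element.tensor, hq, hq', he]
  · cases τ <;> simp [attachBridge, h, Element.tensor, braidWith, hq, hq', he, hnew]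

/-! ### Contraction of all new segments. -/

theorem sum_sum_arrow {α β : Type} [Fintype α] [Fintype β] [DecidableEq α] [DecidableEq β]
    (F : (α ⊕ β → ZMod 2) → ℂ) :
    ∑ s, F s = ∑ a : α → ZMod 2, ∑ b : β → ZMod 2, F (Sum.elim a b) := by
  rw [← Fintype.sum_prod_type' (f := fun a b => F (Sum.elim a b))]
  exact Fintype.sum_equiv (Equiv.sumArrowEquivProdArrow α β (ZMod 2)) _ _ fun s => by
    simp [Equiv.sumArrowEquivProdArrow]

theorem sum_bool_arrow (F : (Bool → ZMod 2) → ℂ) :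
    ∑ u, F u = ∑ e, ∑ e', F (fun b => bif b then e' else e) := by
  rw [← Fintype.sum_prod_type' (f := fun e e' => F (fun b => bif b then e' else e))]
  refine Fintype.sum_equiv ((Equiv.boolArrowEquivProd (ZMod 2))) _ _ fun u => ?_
  congr 1
  funext b
  cases b <;> rfl

theorem sum_prod_bridgeElems {S : Type} (ty : S → StrandType) (s : S → ZMod 2)
    (l₁ l₂ : List (Element S)) (B : Colour) (m : ZMod 2) (q q' r r' : S) :
    ∑ v, ((bridgeElems l₁ l₂ B.bridgeType.tube m B.bridgeType (ty q) (ty r) q q' r r').map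
      (Element.tensor (bridgeTy ty B.bridgeType (ty q) (ty r)) (Sum.elim s v))).prod
      = ((l₁ ++ Element.parity B m q q' r r' :: l₂).map (Element.tensor ty s)).prod := by
  rw [sum_sum_arrow, sum_bool_arrow]
  simp only [sum_sum_arrow, List.map_append, List.prod_append, List.map_cons, List.prod_cons]
  rw [show Element.tensor ty s (Element.parity B m q q' r r')
    = parityCircuit B m (s q) (s q') (s r) (s r') from rfl,
    ← sum_spider_pauli_spider B m (s q) (s q') (s r) (s r')]
  simp only [Finset.mul_sum, Finset.sum_mul]
  refine Finset.sum_congr rfl fun e _ => Finset.sum_congr rfl fun e' _ => ?_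
  set ty' := bridgeTy ty B.bridgeType (ty q) (ty r) with hty'
  rw [← sum_attachBridge B.bridgeType (ty q) (Sum.inl q) (Sum.inl q') (.inr (.inl false))
        (fun l h => .inr (.inr (.inl ⟨l, h⟩))) ty' rfl (fun _ _ => rfl)
        (fun f => Sum.elim s (Sum.elim (fun b => bif b then e' else e) (Sum.elim f 0)))
        (s q) (s q') e (fun _ => rfl) (fun _ => rfl) (fun _ => rfl) (fun _ _ _ => rfl),
    ← sum_attachBridge B.bridgeType (ty r) (Sum.inl r) (Sum.inl r') (.inr (.inl true))
        (fun l h => .inr (.inr (.inr ⟨l, h⟩))) ty' rfl (fun _ _ => rfl)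
        (fun f => Sum.elim s (Sum.elim (fun b => bif b then e' else e) (Sum.elim 0 f)))
        (s r) (s r') e' (fun _ => rfl) (fun _ => rfl) (fun _ => rfl) (fun _ _ _ => rfl)]
  simp only [Finset.mul_sum, Finset.sum_mul]
  rw [Finset.sum_comm]
  refine Finset.sum_congr rfl fun g _ => Finset.sum_congr rfl fun f _ => ?_
  rw [prod_attachBridge_congr B.bridgeType (ty q) (Sum.inl q) (Sum.inl q')
    (.inr (.inl false)) (fun l h => .inr (.inr (.inl ⟨l, h⟩))) ty'
    (Sum.elim s (Sum.elim (fun b => bif b then e' else e) (Sum.elim f 0)))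
    (Sum.elim s (Sum.elim (fun b => bif b then e' else e) (Sum.elim f g)))
    rfl rfl rfl (fun _ _ => rfl),
    prod_attachBridge_congr B.bridgeType (ty r) (Sum.inl r) (Sum.inl r')
    (.inr (.inl true)) (fun l h => .inr (.inr (.inr ⟨l, h⟩))) ty'
    (Sum.elim s (Sum.elim (fun b => bif b then e' else e) (Sum.elim 0 g)))
    (Sum.elim s (Sum.elim (fun b => bif b then e' else e) (Sum.elim f g)))
    rfl rfl rfl (fun _ _ => rfl)]
  simp only [bridgeElems, firstEnd, secondEnd, List.map_append, List.prod_append]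
  rw [prod_tensor_map, prod_tensor_map, show ty' ∘ Sum.inl = ty from rfl]
  simp only [List.map_cons, List.map_nil, List.prod_cons, List.prod_nil, Element.tensor,
    Sum.elim_inl, Sum.elim_inr, Sum.elim_comp_inl, cond_true, cond_false, mul_one]
  ring

theorem computation_replaceByBridge {I O : Type} (C : BraidedCircuit I O)
    (l₁ l₂ : List (Element C.Seg)) (B : Colour) (m : ZMod 2) (q q' r r' : C.Seg)
    (hC : C.elems = l₁ ++ Element.parity B m q q' r r' :: l₂) :
    (C.replaceByBridge l₁ l₂ B m q q' r r').computation = C.computation := by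
  classical
  ext y x
  unfold BraidedCircuit.computation
  refine Eq.trans (Fintype.sum_equiv (Equiv.refl _) _
    (fun s : BridgeSeg C.Seg B.bridgeType (C.ty q) (C.ty r) → ZMod 2 =>
      if (∀ i, s (.inl (C.inp i)) = x i) ∧ (∀ o, s (.inl (C.out o)) = y o) then
        ((bridgeElems l₁ l₂ B.bridgeType.tube m B.bridgeType (C.ty q) (C.ty r) q q' r r').map
          (Element.tensor (bridgeTy C.ty B.bridgeType (C.ty q) (C.ty r)) s)).prod else 0)
      fun _ => rfl) ?_
  rw [sum_sum_arrow]
  refine Finset.sum_congr rfl fun s _ => ?_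
  simp only [Sum.elim_inl]
  -- The boundary condition involves old segments only, so it is constant in the inner sum.
  by_cases hs : (∀ i, s (C.inp i) = x i) ∧ (∀ o, s (C.out o) = y o)
  · refine (Finset.sum_congr rfl fun v _ => if_pos hs).trans (Eq.trans ?_ (if_pos hs).symm)
    rw [hC, sum_prod_bridgeElems]
  · exact (Finset.sum_eq_zero fun v _ => if_neg hs).trans (if_neg hs).symm

/-! ### Correlation surfaces -/

/-- The flow of Pauli operators at an end `e` of a bridge of type `τ` attached to `q → q'`, where
the three segments have types `t`, `t'` and `τ`. -/
def BridgeFlow (τ t t' : StrandType) (q q' e : SurfaceLabel) : Prop :=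
  match τ with
  | .primal => q.x t = q'.x t' ∧ q'.x t' = e.tube ∧ q.z t + q'.z t' + e.sheet = 0
  | .dual => q.z t = q'.z t' ∧ q'.z t' = e.tube ∧ q.x t + q'.x t' + e.sheet = 0

/-- The bridge is the ancilla between its two CNOTs: its tube is the ancilla's exponent there in the
basis opposite to `B`, and its sheet the `B`-exponent, which both CNOTs preserve on the ancilla. -/
theorem exists_bridgeFlow_iff (B : Colour) (t t' u u' : StrandType) (q q' r r' : SurfaceLabel) :
    (∃ e, BridgeFlow B.bridgeType t t' q q' e ∧ BridgeFlow B.bridgeType u u' r r' e) ↔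
      ParityFlow B (q.x t, q.z t) (q'.x t', q'.z t') (r.x u, r.z u) (r'.x u', r'.z u') := by
  cases B
  · simp only [BridgeFlow, Colour.bridgeType, ParityFlow, CnotFlow]
    constructor
    · rintro ⟨⟨e, f⟩, ⟨h1, h2, h3⟩, h4, h5, h6⟩
      dsimp only at *
      refine ⟨(0, f), (e, f), (0, f), rfl, ⟨h1.symm, ?_, ?_, rfl⟩, ⟨h4.symm, ?_, ?_, rfl⟩, rfl⟩ <;>
        dsimp only <;> grind
    · rintro ⟨⟨a, b⟩, ⟨a', b'⟩, ⟨a'', b''⟩, h⟩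
      refine ⟨⟨a', b⟩, ?_⟩
      dsimp only at *
      grind
  · simp only [BridgeFlow, Colour.bridgeType, ParityFlow, CnotFlow]
    constructor
    · rintro ⟨⟨e, f⟩, ⟨h1, h2, h3⟩, h4, h5, h6⟩
      dsimp only at *
      refine ⟨(f, 0), (f, e), (f, 0), rfl, ⟨rfl, ?_, ?_, h1.symm⟩, ⟨rfl, ?_, ?_, h4.symm⟩, rfl⟩ <;>
        dsimp only <;> grind
    · rintro ⟨⟨b, a⟩, ⟨b', a'⟩, ⟨b'', a''⟩, h⟩
      refine ⟨⟨a', b⟩, ?_⟩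
      dsimp only at *
      grind

/-- With a loop, the first closed end admits no tube, so the tube reaching the junction is the
strand's sheet. Conversely, the sheets of the two loop halves add up to that of `e` and are added to
the strand's tube. -/
theorem bridgeFlow_of_attachBridge {S : Type} (τ t : StrandType) (q q' e : S)
    (new : LoopSeg → t ≠ τ → S) (ty : S → StrandType) (l : S → SurfaceLabel)
    (h : ∀ E ∈ attachBridge τ t q q' e new, E.Supports ty l) :
    BridgeFlow τ t t (l q) (l q') (l e) := by
  by_cases ht : t = τ
  · subst ht
    cases t <;>
      simpa [attachBridge, Element.Supports, BridgeFlow, SurfaceLabel.x, SurfaceLabel.z] using h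
  · cases τ <;> cases t <;> first | exact absurd rfl ht | skip
    all_goals
      simp [attachBridge, Element.Supports, braidWith] at h
      simp only [BridgeFlow, SurfaceLabel.x, SurfaceLabel.z]
      grind

/-- The labels of the auxiliary loop around `q → q'`. -/
def loopLabel (q e : SurfaceLabel) : LoopSeg → SurfaceLabel
  | .mid => ⟨q.tube, q.sheet⟩
  | .l₀ => ⟨0, 0⟩
  | .l₁ => ⟨q.sheet, 0⟩
  | .l₂ => ⟨q.sheet, e.sheet⟩
  | .l₃ => ⟨0, e.sheet⟩

/-- The rules leave one bit free, the sheet on the first half of the loop. `loopLabel` sets it to 0,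
so the second half carries the whole sheet of `e`. -/
theorem attachBridge_of_bridgeFlow {S : Type} (τ t : StrandType) (q q' e : S)
    (new : LoopSeg → t ≠ τ → S) (ty : S → StrandType) (l : S → SurfaceLabel)
    (hnew : ∀ k h, l (new k h) = loopLabel (l q) (l e) k)
    (h : BridgeFlow τ t t (l q) (l q') (l e)) :
    ∀ E ∈ attachBridge τ t q q' e new, E.Supports ty l := by
  by_cases ht : t = τ
  · subst ht
    cases t <;>
      simpa [attachBridge, Element.Supports, BridgeFlow, SurfaceLabel.x, SurfaceLabel.z] using h
  · cases τ <;> cases t <;> first | exact absurd rfl ht | skip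
    all_goals
      simp only [BridgeFlow, SurfaceLabel.x, SurfaceLabel.z] at h
      simp [attachBridge, Element.Supports, braidWith, hnew, loopLabel]
      grind

theorem correlations_replaceByBridge {I O : Type} (C : BraidedCircuit I O)
    (l₁ l₂ : List (Element C.Seg)) (B : Colour) (m : ZMod 2) (q q' r r' : C.Seg)
    (hC : C.elems = l₁ ++ Element.parity B m q q' r r' :: l₂)
    (hq : C.ty q = C.ty q') (hr : C.ty r = C.ty r') :
    (C.replaceByBridge l₁ l₂ B m q q' r r').correlations = C.correlations := by
  ext b
  constructor
  · rintro ⟨l, h, hi, ho⟩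
    refine ⟨fun s => l (.inl s), ?_, hi, ho⟩
    obtain ⟨h1, h2, h3, h4, h5⟩ := forall_mem_bridgeElems.1 h
    rw [hC, List.forall_mem_append, List.forall_mem_cons]
    refine ⟨fun E hE => (Element.supports_map _ _ _ _).1 (h1 E hE), ?_,
      fun E hE => (Element.supports_map _ _ _ _).1 (h5 E hE)⟩
    have h3' : l (.inr (.inl false)) = l (.inr (.inl true)) := h3
    have h2' := bridgeFlow_of_attachBridge _ _ _ _ _ _ _ _ h2
    have h4' := bridgeFlow_of_attachBridge _ _ _ _ _ _ _ _ h4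
    simp only [Element.Supports]
    rw [← exists_bridgeFlow_iff, ← hq, ← hr]
    exact ⟨_, h2', h3' ▸ h4'⟩
  · rintro ⟨l, h, hi, ho⟩
    rw [hC, List.forall_mem_append, List.forall_mem_cons] at h
    obtain ⟨h1, h2, h3⟩ := h
    simp only [Element.Supports] at h2
    rw [← exists_bridgeFlow_iff, ← hq, ← hr] at h2
    obtain ⟨e, h4, h5⟩ := h2
    -- Both halves of the bridge get the same label, since a byproduct does not alter surfaces.
    refine ⟨Sum.elim l (Sum.elim (fun _ => e) (Sum.elim (fun k => loopLabel (l q) e k.1)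
      (fun k => loopLabel (l r) e k.1))), forall_mem_bridgeElems.2 ⟨?_, ?_, rfl, ?_, ?_⟩, hi, ho⟩
    · exact fun E hE => (Element.supports_map _ _ _ _).2 (h1 E hE)
    · exact attachBridge_of_bridgeFlow _ _ _ _ _ _ _ _ (fun _ _ => rfl) h4
    · exact attachBridge_of_bridgeFlow _ _ _ _ _ _ _ _ (fun _ _ => rfl) h5
    · exact fun E hE => (Element.supports_map _ _ _ _).2 (h3 E hE)

/-! ### Well-formedness -/

theorem wellTyped_attachBridge {S : Type} (τ t : StrandType) (q q' e : S)
    (new : LoopSeg → t ≠ τ → S) (ty : S → StrandType) (hq : ty q = t) (hq' : ty q' = t)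
    (he : ty e = τ) (hnew : ∀ l h, ty (new l h) = l.ty τ t) :
    ∀ E ∈ attachBridge τ t q q' e new, E.WellTyped ty := by
  by_cases ht : t = τ
  · simp [attachBridge, Element.WellTyped, *]
  · cases τ <;> cases t <;> first | exact absurd rfl ht | skip
    all_goals
      simp [attachBridge, Element.WellTyped, braidWith, LoopSeg.ty, *]

/-- Every loop segment has both ends inside the attachment; outwardly it looks like a single
junction. -/
theorem count_attachBridge {S : Type} [BEq S] (τ t : StrandType) (q q' e : S)
    (new : LoopSeg → t ≠ τ → S) (s : S) :
    ((attachBridge τ t q q' e new).flatMap Element.segments).count s = [q, q', e].count s +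
      if h : t = τ then 0
      else 2 * [new .mid h, new .l₀ h, new .l₁ h, new .l₂ h, new .l₃ h].count s := by
  by_cases ht : t = τ
  · simp [attachBridge, ht, Element.segments]
  · cases τ <;> simp only [attachBridge, ht, Element.segments, braidWith, dite_false,
      List.flatMap_cons, List.flatMap_nil, List.count_append, List.count_cons, List.count_nil] <;>
      ring

/-- The `BEq` instance on the new segments is arbitrary, so that the one stored in the new circuit
fits. -/
theorem count_bridgeElems_inl {S : Type} [BEq S] [LawfulBEq S] (l₁ l₂ : List (Element S))
    (B B' : Colour) (m m' : ZMod 2) (τ t u : StrandType) (q q' r r' s : S)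
    {bT : BEq (BridgeSeg S τ t u)} (hT : @LawfulBEq (BridgeSeg S τ t u) bT) :
    @List.count _ bT (.inl s) ((bridgeElems l₁ l₂ B m τ t u q q' r r').flatMap Element.segments)
      = ((l₁ ++ Element.parity B' m' q q' r r' :: l₂).flatMap Element.segments).count s := by
  simp only [bridgeElems, firstEnd, secondEnd, List.flatMap_append, List.count_append,
    flatMap_segments_map, count_attachBridge, List.flatMap_cons,
    List.count_map_of_injective _ _ (Sum.inl_injective (α := S))]
  classical
  simp [List.count_cons, Element.segments]
  omega

theorem count_bridgeElems_inr {S : Type} (l₁ l₂ : List (Element S))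
    (B : Colour) (m : ZMod 2) (τ t u : StrandType) (q q' r r' : S)
    {bT : BEq (BridgeSeg S τ t u)} (hT : @LawfulBEq (BridgeSeg S τ t u) bT) (k) :
    @List.count _ bT (.inr k)
      ((bridgeElems l₁ l₂ B m τ t u q q' r r').flatMap Element.segments) = 2 := by
  have h : ∀ L : List S, @List.count _ bT (.inr k) (L.map (Sum.inl : S → BridgeSeg S τ t u)) = 0 := by
    intro L
    rw [List.count_eq_zero]
    simp
  simp only [bridgeElems, firstEnd, secondEnd, List.flatMap_append, List.count_append,
    flatMap_segments_map, count_attachBridge, h]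
  rcases k with b | ⟨k, hk⟩ | ⟨k, hk⟩
  · cases b <;> simp [Element.segments]
  · cases k <;> simp [Element.segments, hk]
  · cases k <;> simp [Element.segments, hk]

theorem card_filter_congr {α : Type} [Fintype α] {p p' : α → Prop} {_ : DecidablePred p}
    {_ : DecidablePred p'} (h : ∀ a, p a ↔ p' a) :
    (Finset.univ.filter p).card = (Finset.univ.filter p').card :=
  congrArg Finset.card (Finset.filter_congr fun a _ => h a)

theorem card_filter_eq_zero {α : Type} [Fintype α] {p : α → Prop} {_ : DecidablePred p}
    (h : ∀ a, ¬ p a) : (Finset.univ.filter p).card = 0 :=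
  Finset.card_eq_zero.2 (Finset.filter_false_of_mem fun a _ => h a)

theorem wellFormed_replaceByBridge {I O : Type} [Fintype I] [Fintype O] (C : BraidedCircuit I O)
    (hwf : C.WellFormed) (l₁ l₂ : List (Element C.Seg)) (B : Colour) (m : ZMod 2)
    (q q' r r' : C.Seg) (hC : C.elems = l₁ ++ Element.parity B m q q' r r' :: l₂) :
    (C.replaceByBridge l₁ l₂ B m q q' r r').WellFormed := by
  obtain ⟨hty, hcount⟩ := hwf
  rw [hC, List.forall_mem_append, List.forall_mem_cons] at hty
  obtain ⟨h1, ⟨hq, hr⟩, h2⟩ := hty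
  constructor
  · refine forall_mem_bridgeElems.2 ⟨?_, ?_, rfl, ?_, ?_⟩
    · exact fun E hE => (Element.wellTyped_map _ _ _).2 (h1 E hE)
    · exact wellTyped_attachBridge _ _ _ _ _ _ _ rfl hq.symm rfl (fun _ _ => rfl)
    · exact wellTyped_attachBridge _ _ _ _ _ _ _ rfl hr.symm rfl (fun _ _ => rfl)
    · exact fun E hE => (Element.wellTyped_map _ _ _).2 (h2 E hE)
  · have hT := (inferInstance : LawfulBEq (C.replaceByBridge l₁ l₂ B m q q' r r').Seg)
    rintro (s | k)
    · rw [← hcount s, hC]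
      congr 1
      · congr 1
        · exact count_bridgeElems_inl _ _ _ _ _ _ _ _ _ _ _ _ _ _ hT
        · exact card_filter_congr fun i => Sum.inl_injective.eq_iff
      · exact card_filter_congr fun i => Sum.inl_injective.eq_iff
    · refine Eq.trans (congrArg₂ (· + ·) (congrArg₂ (· + ·)
        (count_bridgeElems_inr _ _ _ _ _ _ _ _ _ _ _ hT k)
        (card_filter_eq_zero fun i => Sum.inl_ne_inr))
        (card_filter_eq_zero fun i => Sum.inl_ne_inr)) rfl

/-! ### Eliminating all measurements -/

theorem not_isParity_of_mem_attachBridge {S : Type} (τ t : StrandType) (q q' e : S)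
    (new : LoopSeg → t ≠ τ → S) : ∀ E ∈ attachBridge τ t q q' e new, ¬ E.IsParity := by
  by_cases ht : t = τ
  · simp [attachBridge, ht, Element.IsParity]
  · cases τ <;> simp [attachBridge, ht, Element.IsParity, braidWith]

/-- The number of two-body measurements in a list of pieces. -/
def parityCount {S : Type} (L : List (Element S)) : ℕ :=
  (L.map fun E => match E with
    | .parity _ _ _ _ _ _ => 1
    | _ => 0).sum

theorem parityCount_append {S : Type} (L L' : List (Element S)) :
    parityCount (L ++ L') = parityCount L + parityCount L' := by
  simp [parityCount]

theorem parityCount_map {S T : Type} (f : S → T) (L : List (Element S)) :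
    parityCount (L.map (Element.map f)) = parityCount L := by
  unfold parityCount
  rw [List.map_map]
  congr 1
  exact List.map_congr_left fun E _ => by cases E <;> rfl

theorem parityCount_eq_zero {S : Type} {L : List (Element S)} :
    parityCount L = 0 ↔ ∀ E ∈ L, ¬ E.IsParity := by
  simp only [parityCount, List.sum_eq_zero_iff, List.forall_mem_map]
  refine forall₂_congr fun E _ => ?_
  cases E <;> simp [Element.IsParity]

theorem parityCount_bridgeElems {S : Type} (l₁ l₂ : List (Element S)) (B B' : Colour)
    (m m' : ZMod 2) (τ t u : StrandType) (q q' r r' : S) :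
    parityCount (bridgeElems l₁ l₂ B m τ t u q q' r r') + 1
      = parityCount (l₁ ++ Element.parity B' m' q q' r r' :: l₂) := by
  simp only [bridgeElems, firstEnd, secondEnd, parityCount_append, parityCount_map,
    parityCount_eq_zero.2 (not_isParity_of_mem_attachBridge _ _ _ _ _ _)]
  simp only [parityCount, List.map_cons, List.sum_cons, List.map_nil, List.sum_nil]
  omega

/-- Each replacement removes one measurement and creates none. The circuit is quantified inside the
induction because its segment type grows. -/
theorem exists_parity_free {I O : Type} [Fintype I] [Fintype O] (n : ℕ) :
    ∀ C : BraidedCircuit I O, C.WellFormed →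
      parityCount C.elems = n →
      ∃ C' : BraidedCircuit I O, Relation.ReflTransGen BridgeReplacement C C' ∧
        (∀ E ∈ C'.elems, ¬ E.IsParity) ∧ C'.WellFormed ∧
        C'.computation = C.computation ∧ C'.correlations = C.correlations := by
  induction n with
  | zero =>
    intro C hC hn
    exact ⟨C, .refl, parityCount_eq_zero.1 hn, hC, rfl, rfl⟩
  | succ n ih =>
    intro C hC hn
    have hne : ¬ ∀ E ∈ C.elems, ¬ E.IsParity := fun h => by
      rw [parityCount_eq_zero.2 h] at hn
      omega
    push Not at hne
    obtain ⟨E, hE, hp⟩ := hne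
    obtain ⟨l₁, l₂, h⟩ := List.append_of_mem hE
    cases E with
    | parity B m q q' r r' =>
      have hty := hC.1 _ hE
      obtain ⟨C', h1, h2, h3, h4, h5⟩ := ih (C.replaceByBridge l₁ l₂ B m q q' r r')
        (wellFormed_replaceByBridge C hC l₁ l₂ B m q q' r r' h)
        (Nat.succ_injective ((parityCount_bridgeElems _ _ _ B _ m _ _ _ _ _ _ _).trans (h ▸ hn)))
      exact ⟨C', .head (.replace C l₁ l₂ B m q q' r r' h) h1, h2, h3,
        h4.trans (computation_replaceByBridge C l₁ l₂ B m q q' r r' h),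
        h5.trans (correlations_replaceByBridge C l₁ l₂ B m q q' r r' h hty.1 hty.2)⟩
    | _ => simp [Element.IsParity] at hp

/-! ### Two strands and a bridge -/

/-- All four strand segments are inputs or outputs, so only a bridge label can remain to be summed.
-/
theorem eq_of_boundary {α : Type} {x y : Fin 2 → α} {s : Fin 2 × Bool → α}
    (h : (∀ i, s (i, false) = x i) ∧ ∀ o, s (o, true) = y o) :
    s = fun p => bif p.2 then y p.1 else x p.1 := by
  funext ⟨i, b⟩
  cases b
  exacts [h.1 i, h.2 i]

theorem sum_ite_boundary (x y : Fin 2 → ZMod 2) (F : (Fin 2 × Bool → ZMod 2) → ℂ)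
    {_ : DecidablePred fun s : Fin 2 × Bool → ZMod 2 =>
      (∀ i, s (i, false) = x i) ∧ ∀ o, s (o, true) = y o} :
    (∑ s : Fin 2 × Bool → ZMod 2,
      if (∀ i, s (i, false) = x i) ∧ ∀ o, s (o, true) = y o then F s else 0)
      = F (fun p => bif p.2 then y p.1 else x p.1) := by
  rw [Finset.sum_eq_single (fun p : Fin 2 × Bool => bif p.2 then y p.1 else x p.1)]
  · exact if_pos ⟨fun _ => rfl, fun _ => rfl⟩
  · exact fun s _ hs => if_neg fun h => hs (eq_of_boundary h)
  · exact fun h => absurd (Finset.mem_univ _) h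

theorem sum_ite_boundary_unit (x y : Fin 2 → ZMod 2) (F : (Fin 2 × Bool ⊕ Unit → ZMod 2) → ℂ)
    {_ : DecidablePred fun s : Fin 2 × Bool ⊕ Unit → ZMod 2 =>
      (∀ i, s (.inl (i, false)) = x i) ∧ ∀ o, s (.inl (o, true)) = y o} :
    (∑ s : Fin 2 × Bool ⊕ Unit → ZMod 2,
      if (∀ i, s (.inl (i, false)) = x i) ∧ ∀ o, s (.inl (o, true)) = y o then F s else 0)
      = ∑ e, F (Sum.elim (fun p => bif p.2 then y p.1 else x p.1) fun _ => e) := by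
  rw [sum_sum_arrow, Finset.sum_comm]
  refine Fintype.sum_equiv (Equiv.funUnique Unit (ZMod 2)) _ _ fun u => ?_
  exact sum_ite_boundary x y fun s => F (Sum.elim s u)

theorem computation_twoStrandMeasurement (t : StrandType) (B : Colour)
    (y x : Fin 2 → ZMod 2) :
    (twoStrandMeasurement t B).computation y x = parityCircuit B 0 (x 0) (y 0) (x 1) (y 1) := by
  refine (sum_ite_boundary x y fun s =>
    ([Element.parity B 0 (0, false) (0, true) (1, false) (1, true)].map
      (Element.tensor (fun _ => t) s)).prod).trans ?_
  simp [Element.tensor]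

theorem computation_twoStrandBridge (t : StrandType) (y x : Fin 2 → ZMod 2) :
    (twoStrandBridge t).computation y x
      = ∑ e, spider t.sheet (x 0) (y 0) e * spider t.sheet (x 1) (y 1) e := by
  refine (sum_ite_boundary_unit x y fun s =>
    ((twoStrandBridge t).elems.map (Element.tensor (twoStrandBridge t).ty s)).prod).trans ?_
  simp [twoStrandBridge, Element.tensor]

theorem computation_twoStrand_iff (t : StrandType) (B : Colour) :
    (∃ c : ℂ, (twoStrandMeasurement t B).computation = c • (twoStrandBridge t).computation) ↔
      t = B.bridgeType := by
  constructor
  · rintro ⟨c, hc⟩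
    have h : ∀ y x : Fin 2 → ZMod 2, parityCircuit B 0 (x 0) (y 0) (x 1) (y 1)
        = c * ∑ e, spider t.sheet (x 0) (y 0) e * spider t.sheet (x 1) (y 1) e := by
      intro y x
      rw [← computation_twoStrandMeasurement t, hc, ← computation_twoStrandBridge]
      rfl
    -- The entry from `00` to `11` vanishes for a `ZZ`-measurement and a primal bridge, but not for
    -- an `XX`-measurement or a dual bridge. For `ZZ` against dual it forces `c = 0`, which the
    -- entry from `00` to `00` refutes.
    have h1 := h 1 0
    have h2 := h 0 0
    cases B <;> cases t <;> first | rfl | exfalso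
    · simp [parityCircuit_Z, spider_X, StrandType.sheet, sum_zmod_two] at h1 h2
      simp [h1 one_add_one_zmod_two] at h2
    · simp [parityCircuit_X, spider_Z, StrandType.sheet] at h1
  · rintro rfl
    refine ⟨1, ?_⟩
    rw [one_smul]
    ext y x
    rw [computation_twoStrandMeasurement, computation_twoStrandBridge, ← sum_spider_pauli_spider]
    refine Finset.sum_congr rfl fun e _ => ?_
    cases B <;> simp [pauli, Colour.bridgeType, StrandType.tube]

theorem mem_correlations_twoStrandMeasurement (t : StrandType) (B : Colour)
    (b : (Fin 2 → SurfaceLabel) × (Fin 2 → SurfaceLabel)) :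
    b ∈ (twoStrandMeasurement t B).correlations ↔
      ∃ e, BridgeFlow B.bridgeType t t (b.1 0) (b.2 0) e ∧
        BridgeFlow B.bridgeType t t (b.1 1) (b.2 1) e := by
  rw [exists_bridgeFlow_iff]
  constructor
  · rintro ⟨l, h, hi, ho⟩
    rw [← hi, ← hi, ← ho, ← ho]
    have h' := h _ (List.mem_singleton_self _)
    exact h'
  · intro h
    exact ⟨fun p : Fin 2 × Bool => bif p.2 then b.2 p.1 else b.1 p.1,
      List.forall_mem_singleton.2 h, fun _ => rfl, fun _ => rfl⟩

theorem supports_junction_iff {S : Type} (t : StrandType) (ty : S → StrandType)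
    (l : S → SurfaceLabel) (a b c : S) :
    (Element.junction a b c).Supports ty l ↔ BridgeFlow t t t (l a) (l b) (l c) := by
  cases t <;> rfl

theorem mem_correlations_twoStrandBridge (t : StrandType)
    (b : (Fin 2 → SurfaceLabel) × (Fin 2 → SurfaceLabel)) :
    b ∈ (twoStrandBridge t).correlations ↔
      ∃ e, BridgeFlow t t t (b.1 0) (b.2 0) e ∧ BridgeFlow t t t (b.1 1) (b.2 1) e := by
  constructor
  · rintro ⟨l, h, hi, ho⟩
    refine ⟨l (.inr ()), ?_⟩
    rw [← hi, ← hi, ← ho, ← ho]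
    obtain ⟨h1, h2⟩ := List.forall_mem_cons.1 h
    exact ⟨(supports_junction_iff t _ _ _ _ _).1 h1,
      (supports_junction_iff t _ _ _ _ _).1 (List.forall_mem_singleton.1 h2)⟩
  · rintro ⟨e, h1, h2⟩
    exact ⟨Sum.elim (fun p : Fin 2 × Bool => bif p.2 then b.2 p.1 else b.1 p.1) (fun _ => e),
      List.forall_mem_cons.2 ⟨(supports_junction_iff t _ _ _ _ _).2 h1,
        List.forall_mem_singleton.2 ((supports_junction_iff t _ _ _ _ _).2 h2)⟩,
      fun _ => rfl, fun _ => rfl⟩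

theorem correlations_twoStrand_iff (t : StrandType) (B : Colour) :
    (twoStrandMeasurement t B).correlations = (twoStrandBridge t).correlations ↔
      t = B.bridgeType := by
  constructor
  · intro h
    -- Sheets on both outputs, none on the inputs: they join through the sheet of the bridge. A
    -- mismatched measurement must conserve the sheet along each strand, so it forbids this.
    have h1 := Set.ext_iff.1 h (fun _ => ⟨0, 0⟩, fun _ => ⟨0, 1⟩)
    rw [mem_correlations_twoStrandMeasurement, mem_correlations_twoStrandBridge] at h1
    have h2 : ∃ e, BridgeFlow t t t ⟨0, 0⟩ ⟨0, 1⟩ e ∧ BridgeFlow t t t ⟨0, 0⟩ ⟨0, 1⟩ e :=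
      ⟨⟨0, 1⟩, by cases t <;> simp [BridgeFlow, SurfaceLabel.x, SurfaceLabel.z] <;> decide⟩
    obtain ⟨e, h3, -⟩ := h1.2 h2
    cases B <;> cases t <;> first | rfl | exfalso
    all_goals simp [BridgeFlow, Colour.bridgeType, SurfaceLabel.x, SurfaceLabel.z] at h3
  · rintro rfl
    ext b
    rw [mem_correlations_twoStrandMeasurement, mem_correlations_twoStrandBridge]

theorem mainTheorem5 {I O : Type} [Fintype I] [Fintype O] :
    (∀ (C : BraidedCircuit I O), C.WellFormed →
      ∀ (l₁ l₂ : List (Element C.Seg)) (B : Colour) (m : ZMod 2) (q q' r r' : C.Seg),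
        C.elems = l₁ ++ Element.parity B m q q' r r' :: l₂ →
          (C.replaceByBridge l₁ l₂ B m q q' r r').WellFormed ∧
          (C.replaceByBridge l₁ l₂ B m q q' r r').computation = C.computation ∧
          (C.replaceByBridge l₁ l₂ B m q q' r r').correlations = C.correlations) ∧
    (∀ (C : BraidedCircuit I O), C.WellFormed →
      ∃ C' : BraidedCircuit I O, Relation.ReflTransGen BridgeReplacement C C' ∧
        (∀ E ∈ C'.elems, ¬ E.IsParity) ∧ C'.WellFormed ∧
        C'.computation = C.computation ∧ C'.correlations = C.correlations) ∧
    (∀ (t : StrandType) (B : Colour),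
      ((∃ c : ℂ, (twoStrandMeasurement t B).computation = c • (twoStrandBridge t).computation) ↔
        t = B.bridgeType) ∧
      ((twoStrandMeasurement t B).correlations = (twoStrandBridge t).correlations ↔
        t = B.bridgeType)) := by
  refine ⟨fun C hC l₁ l₂ B m q q' r r' h => ?_, fun C hC => exists_parity_free _ C hC rfl,
    fun t B => ⟨computation_twoStrand_iff t B, correlations_twoStrand_iff t B⟩⟩
  have hty : (Element.parity B m q q' r r').WellTyped C.ty := hC.1 _ (by simp [h])
  exact ⟨wellFormed_replaceByBridge C hC l₁ l₂ B m q q' r r' h,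
    computation_replaceByBridge C l₁ l₂ B m q q' r r' h,
    correlations_replaceByBridge C l₁ l₂ B m q q' r r' h hty.1 hty.2⟩
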